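/- Let $M>0$ and let the extreme Reissner–Nordström spacetime be the set of $(v,x)$ with $v\in\mathbb R$ and $x\in\mathbb R^3\setminus\{0\}$. Write $x=r\,(\sin\theta\cos\phi,\sin\theta\sin\phi,\cos\theta)$ with $r=|x|$. The metric is $$ds^2=-f\,dv^2+2\,dv\,dr+r^2\left(d\theta^2+\sin^2\theta\,d\phi^2\right),\qquad f=1-\frac{2m(r)}{r}=\left(1-\frac Mr\right)^2,\quad m(r)=M-\frac{M^2}{2r},$$ time oriented so that the null field $-\partial_r$ is future directed. Let $\mathcal B=\{0<r<M\}$ be its black hole region. Definitions. A causal vector is a vector $w\ne0$ with $\langle w,w\rangle\le0$. Submanifolds are smooth, embedded and without boundary. A spacelike hypersurface $\Sigma$ with smooth future causal normal field $N$ is *$k$-future convex* if, for every $p\in\Sigma$ and every $k$-dimensional spacelike subspace $W\subset T_p\Sigma$ with basis $e_1,\dots,e_k$ and Gram matrix $h_{\alpha\beta}=\langle e_\alpha,e_\beta\rangle$, one has $h^{\alpha\beta}\langle\nabla_{e_\alpha}N,e_\beta\rangle\ge0$ (this does not depend on the choice of $N$). The mean curvature vector of a spacelike submanifold $S$ with tangent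 basis fields $e_\alpha$ is $H=-h^{\alpha\beta}(\nabla_{e_\alpha}e_\beta)^\perp$. A *closed trapped submanifold* is a nonempty compact spacelike submanifold on which $H$ is everywhere future timelike; it is called a *closed trapped surface* if its dimension is $2$ and a *trapped loop* if its dimension is $1$. Then: 1. $\partial_v$ is future timelike on $\mathcal B$. 2. $\mathcal B$ has a smooth foliation by connected embedded hypersurfaces that are spacelike, orthogonal to $\partial_v$ and $1$-future convex. 3. No closed trapped surface is contained in $\mathcal B$. 4. No trapped loop is contained in $\mathcal B$. -/

import Mathlib

open scoped ContDiff Topology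

noncomputable section

namespace Trapped

/-! ### Lorentzian geometry in a global chart

A spacetime covered by one chart is an open subset of a finite-dimensional real vector space `E`,
with a metric field `g` and a causal field `o` that fixes the time orientation. The norm of `E`
only serves to speak of smoothness. -/

section Geometry

variable {E : Type*} [NormedAddCommGroup E] [NormedSpace ℝ E]

/-- The Christoffel symbols of the first kind,
`Z ↦ (∂_X g(Y, Z) + ∂_Y g(X, Z) - ∂_Z g(X, Y)) / 2`. -/
def christoffelFirst (g : E → E →L[ℝ] E →L[ℝ] ℝ) (p X Y : E) : E →L[ℝ] ℝ :=
  (1 / 2 : ℝ) • (fderiv ℝ g p X Y + fderiv ℝ g p Y X - ((fderiv ℝ g p).flip X).flip Y)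

/-- The Christoffel symbols `Γ(X, Y)`; the index is raised with the inverse of the metric,
seen as a map from vectors to covectors. -/
def christoffel (g : E → E →L[ℝ] E →L[ℝ] ℝ) (p X Y : E) : E :=
  (g p).inverse (christoffelFirst g p X Y)

/-- The Levi-Civita covariant derivative `∇_X N` at `p` of a vector field `N`. -/
def covDeriv (g : E → E →L[ℝ] E →L[ℝ] ℝ) (N : E → E) (p X : E) : E :=
  fderiv ℝ N p X + christoffel g p X (N p)

/-- The causal vector `w` at `p` lies in the half cone of the causal vector `o p`. -/
def IsFutureCausal (g : E → E →L[ℝ] E →L[ℝ] ℝ) (o : E → E) (p w : E) : Prop :=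
  w ≠ 0 ∧ g p w w ≤ 0 ∧ (g p (o p) w < 0 ∨ ∃ c : ℝ, 0 < c ∧ w = c • o p)

/-- The vector `w` at `p` is timelike and future directed. -/
def IsFutureTimelike (g : E → E →L[ℝ] E →L[ℝ] ℝ) (o : E → E) (p w : E) : Prop :=
  g p w w < 0 ∧ IsFutureCausal g o p w

/-- `φ : O → S` is a smooth local parametrization of the `k`-dimensional set `S`: an immersion
and a homeomorphism from the open set `O` of `ℝ^k` onto a relatively open subset of `S`. -/
structure IsLocalParam {k : ℕ} (S : Set E) (φ : EuclideanSpace ℝ (Fin k) → E)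
    (O : Set (EuclideanSpace ℝ (Fin k))) : Prop where
  isOpen : IsOpen O
  smooth : ContDiffOn ℝ ∞ φ O
  immersion : ∀ u ∈ O, Function.Injective (fderiv ℝ φ u)
  isEmbedding : Topology.IsEmbedding (O.domRestrict φ)
  image : ∃ V : Set E, IsOpen V ∧ φ '' O = S ∩ V

/-- `S` is a (boundaryless, embedded, smooth) submanifold of dimension `k`. -/
def IsSubmanifold (k : ℕ) (S : Set E) : Prop :=
  ∀ p ∈ S, ∃ (φ : EuclideanSpace ℝ (Fin k) → E) (O : Set (EuclideanSpace ℝ (Fin k))),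
    IsLocalParam S φ O ∧ p ∈ φ '' O

/-- The vectors tangent to `S` at `p`: velocities at `p` of smooth curves in `S`. -/
def tangentVectors (S : Set E) (p : E) : Set E :=
  {w | ∃ c : ℝ → E, ContDiffAt ℝ ∞ c 0 ∧ c 0 = p ∧ (∀ᶠ t in 𝓝 (0 : ℝ), c t ∈ S) ∧
    deriv c 0 = w}

/-- The metric induced on `S` is positive definite. -/
def IsSpacelike (g : E → E →L[ℝ] E →L[ℝ] ℝ) (S : Set E) : Prop :=
  ∀ p ∈ S, ∀ w ∈ tangentVectors S p, w ≠ 0 → 0 < g p w w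

/-- The Gram matrix `h_{αβ} = g(e_α, e_β)` at `p`. -/
def gram (g : E → E →L[ℝ] E →L[ℝ] ℝ) (p : E) {k : ℕ} (e : Fin k → E) :
    Matrix (Fin k) (Fin k) ℝ :=
  Matrix.of fun α β => g p (e α) (e β)

/-- The component of `w` orthogonal to the span of the vectors `e_α`. -/
def normalPart (g : E → E →L[ℝ] E →L[ℝ] ℝ) (p : E) {k : ℕ} (e : Fin k → E) (w : E) : E :=
  w - ∑ α, ∑ β, ((gram g p e)⁻¹ α β * g p w (e α)) • e β

/-- The coordinate field `e_α = ∂_α φ` of a parametrization. -/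
def coordField {k : ℕ} (φ : EuclideanSpace ℝ (Fin k) → E) (α : Fin k)
    (u : EuclideanSpace ℝ (Fin k)) : E :=
  fderiv ℝ φ u (EuclideanSpace.single α 1)

/-- The covariant derivative `∇_{e_α} e_β` of a coordinate field along the parametrized set. -/
def covDerivCoord (g : E → E →L[ℝ] E →L[ℝ] ℝ) {k : ℕ} (φ : EuclideanSpace ℝ (Fin k) → E)
    (α β : Fin k) (u : EuclideanSpace ℝ (Fin k)) : E :=
  fderiv ℝ (coordField φ β) u (EuclideanSpace.single α 1) +
    christoffel g (φ u) (coordField φ α u) (coordField φ β u)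

/-- The mean curvature vector `H = - h^{αβ} (∇_{e_α} e_β)^⊥` at `φ u`. -/
def meanCurvature (g : E → E →L[ℝ] E →L[ℝ] ℝ) {k : ℕ} (φ : EuclideanSpace ℝ (Fin k) → E)
    (u : EuclideanSpace ℝ (Fin k)) : E :=
  -∑ α, ∑ β, (gram g (φ u) fun γ => coordField φ γ u)⁻¹ α β •
    normalPart g (φ u) (fun γ => coordField φ γ u) (covDerivCoord g φ α β u)

/-- The `k`-dimensional set `S` satisfies the trapping condition at `p`: its mean curvature
vector (which does not depend on the parametrization) is future timelike at `p`. -/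
def IsTrappedAt (g : E → E →L[ℝ] E →L[ℝ] ℝ) (o : E → E) (k : ℕ) (S : Set E) (p : E) : Prop :=
  ∃ (φ : EuclideanSpace ℝ (Fin k) → E) (O : Set (EuclideanSpace ℝ (Fin k))),
    IsLocalParam S φ O ∧ ∃ u ∈ O, φ u = p ∧ IsFutureTimelike g o p (meanCurvature g φ u)

/-- `S` is a closed trapped submanifold of dimension `k`: a nonempty compact spacelike submanifold
(without boundary) whose mean curvature vector is everywhere future timelike. -/
structure IsClosedTrapped (g : E → E →L[ℝ] E →L[ℝ] ℝ) (o : E → E) (k : ℕ) (S : Set E) :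
    Prop where
  nonempty : S.Nonempty
  isCompact : IsCompact S
  isSubmanifold : IsSubmanifold k S
  isSpacelike : IsSpacelike g S
  isTrapped : ∀ p ∈ S, IsTrappedAt g o k S p

/-- A trapped loop is a closed trapped submanifold of dimension one. -/
def IsTrappedLoop (g : E → E →L[ℝ] E →L[ℝ] ℝ) (o : E → E) (S : Set E) : Prop :=
  IsClosedTrapped g o 1 S

/-- A closed trapped surface is a closed trapped submanifold of codimension two. -/
def IsClosedTrappedSurface (g : E → E →L[ℝ] E →L[ℝ] ℝ) (o : E → E) (S : Set E) : Prop :=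
  IsClosedTrapped g o (Module.finrank ℝ E - 2) S

/-- The hypersurface `Σ` is `k`-future convex: for a smooth future normal field `N` (the choice
does not matter) the trace of `∇_a N_b` over every `k`-dimensional spacelike subspace of each
tangent space of `Σ`, computed in a basis `e`, is nonnegative. -/
def IsFutureConvex (g : E → E →L[ℝ] E →L[ℝ] ℝ) (o : E → E) (k : ℕ) (Sig : Set E) : Prop :=
  ∃ (N : E → E) (V : Set E), IsOpen V ∧ Sig ⊆ V ∧ ContDiffOn ℝ ∞ N V ∧
    ∀ p ∈ Sig, IsFutureCausal g o p (N p) ∧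
      (∀ w ∈ tangentVectors Sig p, g p (N p) w = 0) ∧
      ∀ e : Fin k → E, LinearIndependent ℝ e →
        (∀ w ∈ Submodule.span ℝ (Set.range e),
          w ∈ tangentVectors Sig p ∧ (w ≠ 0 → 0 < g p w w)) →
        0 ≤ ∑ α, ∑ β, (gram g p e)⁻¹ α β * g p (covDeriv g N p (e α)) (e β)

/-- The sets in `𝓛` are the leaves of a smooth foliation of `Z` by embedded `n`-dimensional
hypersurfaces: they are nonempty, connected, disjoint, cover `Z`, and around each point of `Z`
there is a smooth chart onto a box in which every leaf is a countable union of slices. -/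
structure IsHypersurfaceFoliation (n : ℕ) (Z : Set E) (𝓛 : Set (Set E)) : Prop where
  isSubmanifold : ∀ L ∈ 𝓛, IsSubmanifold n L
  isConnected : ∀ L ∈ 𝓛, IsConnected L
  disjoint : 𝓛.PairwiseDisjoint id
  cover : ⋃₀ 𝓛 = Z
  flatChart : ∀ p ∈ Z, ∃ Ψ : OpenPartialHomeomorph E (EuclideanSpace ℝ (Fin n) × ℝ),
    p ∈ Ψ.source ∧ Ψ.source ⊆ Z ∧
    ContDiffOn ℝ ∞ Ψ Ψ.source ∧ ContDiffOn ℝ ∞ Ψ.symm Ψ.target ∧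
    (∃ (a : EuclideanSpace ℝ (Fin n)) (ρ s t : ℝ),
      Ψ.target = Metric.ball a ρ ×ˢ Set.Ioo s t) ∧
    ∀ L ∈ 𝓛, ∃ T : Set ℝ, T.Countable ∧ L ∩ Ψ.source = {q ∈ Ψ.source | (Ψ q).2 ∈ T}

end Geometry

/-! ### The extreme Reissner-Nordström spacetime

A point is a pair `(v, x)` with `x` in `ℝ³` minus the origin. Here `r = ‖x‖`, and the angles
`(θ, φ)` are those of `x`: `x = r (sin θ cos φ, sin θ sin φ, cos θ)`. -/

/-- The space that holds the global chart `(v, x)`. -/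
abbrev Chart : Type := ℝ × EuclideanSpace ℝ (Fin 3)

/-- The function `f(r) = 1 - 2 m(r) / r` with `m(r) = M - M ^ 2 / (2 r)`; it is `(1 - M / r) ^ 2`. -/
def lapse (M r : ℝ) : ℝ := 1 - 2 * (M - M ^ 2 / (2 * r)) / r

/-- The one-form `dv`. -/
def dv : Chart →L[ℝ] ℝ := ContinuousLinearMap.fst ℝ ℝ (EuclideanSpace ℝ (Fin 3))

/-- The one-form `dr`, where `r = ‖x‖`, that is, `dr(X) = ⟪x, X⟫ / r`. -/
def dr (p : Chart) : Chart →L[ℝ] ℝ :=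
  ‖p.2‖⁻¹ • (innerSL ℝ p.2).comp (ContinuousLinearMap.snd ℝ ℝ (EuclideanSpace ℝ (Fin 3)))

/-- The one-form `dx_i` of the Cartesian coordinate `x_i`. -/
def dx (i : Fin 3) : Chart →L[ℝ] ℝ :=
  (EuclideanSpace.proj i : EuclideanSpace ℝ (Fin 3) →L[ℝ] ℝ).comp
    (ContinuousLinearMap.snd ℝ ℝ (EuclideanSpace ℝ (Fin 3)))

/-- The tensor `r² (dθ² + sin² θ dφ²)`, which is the Euclidean metric `∑ dx_i²` minus `dr²`. -/
def angular (p : Chart) : Chart →L[ℝ] Chart →L[ℝ] ℝ :=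
  ∑ i, (dx i).smulRight (dx i) - (dr p).smulRight (dr p)

/-- The metric `- f dv² + 2 dv dr + r² (dθ² + sin² θ dφ²)` of mass `M`. -/
def ernMetric (M : ℝ) (p : Chart) : Chart →L[ℝ] Chart →L[ℝ] ℝ :=
  (-lapse M ‖p.2‖) • dv.smulRight dv + (dv.smulRight (dr p) + (dr p).smulRight dv) + angular p

/-- The null field `-∂_r`, at fixed `v` and angles, which is future directed. -/
def ernFuture (p : Chart) : Chart := (0, -(‖p.2‖⁻¹ • p.2))

/-- The field `∂_v`, at fixed `r` and angles. -/
def partialV : Chart := (1, 0)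

/-- The black hole region `0 < r < M`. -/
def blackHole (M : ℝ) : Set Chart := {p | 0 < ‖p.2‖ ∧ ‖p.2‖ < M}

end Trapped

end

open Trapped

set_option maxSynthPendingDepth 3

open scoped ContDiff Topology

noncomputable section

namespace Trapped

/-! The field `∂_v` is Killing, timelike where `0 < r < M`, and orthogonal to the level sets of `t =
v - r*(r)` with `dr*/dr = 1/f`: indeed `dt = -f⁻¹ g(∂_v, ·)` (`hasFDerivAt_staticTime`). These level
sets are graphs over the punctured ball, which gives the foliation, and Killing's equation makes
`g(∇_X ∂_v, X)` vanish, which gives convexity. For trapping, minimize `t` over the compact set `S`.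
At a minimum `∂_v` is normal to `S`, and nonnegativity of the second derivative of `t` along `S`
reads `g(∂_v, ∇_w w) ≤ 0` for tangent `w` (`second_order_staticTime`, `sum_covDerivCoord_nonpos`).
Tracing with the inverse Gram matrix yields `g(∂_v, H) ≥ 0`, whereas a future timelike `H` has
`g(∂_v, H) < 0`. The dimension of `S` plays no role, so `not_isClosedTrapped` covers surfaces and
loops together. -/

/-! ### The metric and the causal character of `∂_v` -/

theorem ernMetric_apply (M : ℝ) (p X Y : Chart) :
    ernMetric M p X Y = -lapse M ‖p.2‖ * (X.1 * Y.1) + (X.1 * dr p Y + dr p X * Y.1) +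
      (inner ℝ X.2 Y.2 - dr p X * dr p Y) := by
  simp [ernMetric, angular, dv, dx, PiLp.inner_apply, mul_comm, Fin.sum_univ_three]

theorem dr_apply (p X : Chart) : dr p X = ‖p.2‖⁻¹ * inner ℝ p.2 X.2 := by
  simp [dr]

theorem dr_partialV (p : Chart) : dr p partialV = 0 := by
  simp [dr_apply, partialV]

theorem abs_dr_le (p X : Chart) : |dr p X| ≤ ‖X.2‖ := by
  rw [dr_apply, abs_mul, abs_inv, abs_norm]
  rcases eq_or_lt_of_le (norm_nonneg p.2) with h | h
  · simp [← h]
  · rw [inv_mul_le_iff₀ h]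
    exact abs_real_inner_le_norm _ _

theorem dr_sq_le (p X : Chart) : dr p X ^ 2 ≤ inner ℝ X.2 X.2 := by
  rw [real_inner_self_eq_norm_sq]
  exact sq_le_sq' (by linarith [neg_abs_le (dr p X), abs_dr_le p X])
    ((le_abs_self _).trans (abs_dr_le p X))

theorem ernMetric_comm (M : ℝ) (p X Y : Chart) : ernMetric M p X Y = ernMetric M p Y X := by
  rw [ernMetric_apply, ernMetric_apply, real_inner_comm]
  ring

theorem ernMetric_partialV (M : ℝ) (p X : Chart) :
    ernMetric M p partialV X = -lapse M ‖p.2‖ * X.1 + dr p X := by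
  rw [ernMetric_apply, dr_partialV]
  simp [partialV]

theorem dr_ernFuture {p : Chart} (hp : 0 < ‖p.2‖) : dr p (ernFuture p) = -1 := by
  simp only [dr_apply, ernFuture, inner_neg_right, real_inner_smul_right,
    real_inner_self_eq_norm_sq]
  field_simp

theorem ernMetric_ernFuture (M : ℝ) {p : Chart} (hp : 0 < ‖p.2‖) (X : Chart) :
    ernMetric M p (ernFuture p) X = -X.1 := by
  have h : inner ℝ (ernFuture p).2 X.2 = - dr p X := by
    simp only [ernFuture, dr_apply, inner_neg_left, real_inner_smul_left]
  rw [ernMetric_apply, dr_ernFuture hp, h]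
  simp [ernFuture]

theorem lapse_eq {M r : ℝ} (hr : r ≠ 0) : lapse M r = (1 - M / r) ^ 2 := by
  unfold lapse
  field_simp
  ring

theorem lapse_pos {M r : ℝ} (hr : 0 < r) (hM : r < M) : 0 < lapse M r := by
  rw [lapse_eq hr.ne']
  have : 1 < M / r := (one_lt_div hr).2 hM
  exact sq_pos_of_neg (by linarith)

theorem isFutureTimelike_partialV {M : ℝ} {p : Chart} (hp : p ∈ blackHole M) :
    IsFutureTimelike (ernMetric M) ernFuture p partialV := by
  have h1 : ernMetric M p partialV partialV < 0 := by
    rw [ernMetric_partialV, dr_partialV]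
    simpa [partialV] using lapse_pos hp.1 hp.2
  refine ⟨h1, ?_, h1.le, Or.inl ?_⟩
  · simp [partialV]
  · rw [ernMetric_ernFuture M hp.1]
    simp [partialV]

/-- Write `a = dv(w)` and `b = dr(w)`. The orientation gives `a > 0`; timelikeness and `b² ≤ |w.2|²`
give `2ab < f a²`, so `b < f a`. -/
theorem ernMetric_partialV_neg_of_isFutureTimelike {M : ℝ} {p w : Chart} (hp : p ∈ blackHole M)
    (hw : IsFutureTimelike (ernMetric M) ernFuture p w) : ernMetric M p partialV w < 0 := by
  obtain ⟨hneg, -, -, hfut⟩ := hw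
  have hf := lapse_pos hp.1 hp.2
  have hdr := dr_sq_le p w
  rw [ernMetric_partialV]
  rw [ernMetric_apply] at hneg
  have hw1 : 0 < w.1 := by
    rcases hfut with h | ⟨c, -, rfl⟩
    · rw [ernMetric_ernFuture M hp.1] at h
      linarith
    -- A multiple of `-∂_r` is null, not timelike.
    · exfalso
      simp only [Prod.smul_fst, ernFuture, smul_zero, mul_zero, zero_mul, add_zero] at hneg hdr
      nlinarith
  nlinarith

/-! ### Nondegeneracy, invariance in `v` and Christoffel symbols -/

/-- Pairing a kernel vector with `-∂_r`, with `∂_v` and with itself kills `dv`, `dr` and the rest in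
turn. Invertibility is what gives `inverse` in `christoffel` its meaning. -/
theorem isInvertible_ernMetric (M : ℝ) {p : Chart} (hp : 0 < ‖p.2‖) :
    (ernMetric M p).IsInvertible := by
  have hinj : Function.Injective (ernMetric M p).toLinearMap := by
    rw [← LinearMap.ker_eq_bot, LinearMap.ker_eq_bot']
    intro X hX
    have hX' : ∀ Y, ernMetric M p Y X = 0 := fun Y => by
      rw [ernMetric_comm]
      exact DFunLike.congr_fun hX Y
    have h1 : X.1 = 0 := by
      simpa [ernMetric_ernFuture M hp] using hX' (ernFuture p)
    have h2 : dr p X = 0 := by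
      simpa [ernMetric_partialV, h1] using hX' partialV
    have h3 : X.2 = 0 := by
      simpa [ernMetric_apply, h1, h2] using hX' X
    exact Prod.ext h1 h3
  have hdim : Module.finrank ℝ Chart = Module.finrank ℝ (Chart →L[ℝ] ℝ) :=
    Subspace.dual_finrank_eq.symm.trans LinearMap.toContinuousLinearMap.finrank_eq
  refine ⟨((ernMetric M p).toLinearMap.linearEquivOfInjective hinj hdim).toContinuousLinearEquiv,
    ?_⟩
  exact ContinuousLinearMap.ext fun X => LinearMap.linearEquivOfInjective_apply hinj hdim X

theorem fderiv_clm_apply₂ {E : Type*} [NormedAddCommGroup E] [NormedSpace ℝ E]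
    {g : E → E →L[ℝ] E →L[ℝ] ℝ} {p : E} (hg : DifferentiableAt ℝ g p)  (X Y Z : E) :
    fderiv ℝ g p X Y Z = fderiv ℝ (fun q => g q Y Z) p X := by
  have h1 : HasFDerivAt (fun q => g q Y) _ p := hg.hasFDerivAt.clm_apply (hasFDerivAt_const Y p)
  have h2 : HasFDerivAt (fun q => g q Y Z) _ p := h1.clm_apply (hasFDerivAt_const Z p)
  rw [h2.fderiv]
  simp

theorem differentiableAt_ernMetric (M : ℝ) {p : Chart} (hp : 0 < ‖p.2‖) :
    DifferentiableAt ℝ (ernMetric M) p := by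
  have hx : p.2 ≠ 0 := norm_pos_iff.1 hp
  have hn : DifferentiableAt ℝ (fun q : Chart => ‖q.2‖) p := differentiableAt_snd.norm ℝ hx
  have hd : DifferentiableAt ℝ dr p := by
    -- In terms of the constant forms `dx i`, only scalar coefficients depend on the point.
    have h : dr = fun q => ‖q.2‖⁻¹ • ∑ i, q.2 i • dx i := by
      ext1 q
      apply ContinuousLinearMap.ext
      intro X
      simp [dr_apply, dx, PiLp.inner_apply, mul_comm]
    rw [h]
    fun_prop (disch := exact hp.ne')
  have hl : DifferentiableAt ℝ (fun q : Chart => lapse M ‖q.2‖) p := by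
    unfold lapse
    fun_prop (disch := simp [hx])
  have hb : DifferentiableAt ℝ
      (fun q => ContinuousLinearMap.smulRightL ℝ Chart (Chart →L[ℝ] ℝ) (dr q)) p :=
    (ContinuousLinearMap.smulRightL ℝ Chart (Chart →L[ℝ] ℝ)).differentiableAt.comp p hd
  have h1 : DifferentiableAt ℝ (fun q => dv.smulRight (dr q)) p :=
    (ContinuousLinearMap.smulRightL ℝ Chart (Chart →L[ℝ] ℝ) dv).differentiableAt.comp p hd
  have h2 : DifferentiableAt ℝ (fun q => (dr q).smulRight dv) p :=
    hb.clm_apply (differentiableAt_const dv)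
  have h3 : DifferentiableAt ℝ (fun q => (dr q).smulRight (dr q)) p := hb.clm_apply hd
  unfold ernMetric angular
  fun_prop

theorem fderiv_ernMetric_partialV (M : ℝ) {p : Chart} (hp : 0 < ‖p.2‖) :
    fderiv ℝ (ernMetric M) p partialV = 0 := by
  have h1 : HasDerivAt (fun s : ℝ => p + s • partialV) partialV 0 := by
    simpa using ((hasDerivAt_id (0 : ℝ)).smul_const partialV).const_add p
  have h3 := (differentiableAt_ernMetric M hp).hasFDerivAt.comp_hasDerivAt_of_eq (0 : ℝ) h1
    (by simp)
  have h4 : ernMetric M ∘ (fun s : ℝ => p + s • partialV) = fun _ => ernMetric M p := by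
    ext1 s
    simp [ernMetric, angular, dr, partialV]
  rw [h4] at h3
  exact h3.unique (hasDerivAt_const _ _)

theorem fderiv_ernMetric_comm (M : ℝ) {p : Chart} (hp : 0 < ‖p.2‖) (X Y Z : Chart) :
    fderiv ℝ (ernMetric M) p X Y Z = fderiv ℝ (ernMetric M) p X Z Y := by
  have hg := differentiableAt_ernMetric M hp
  rw [fderiv_clm_apply₂ hg, fderiv_clm_apply₂ hg]
  simp only [ernMetric_comm M _ Y Z]

/-- Pairing with `∂_v` undoes the raised index, and the term differentiating `g` along `∂_v`
vanishes. -/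
theorem ernMetric_partialV_christoffel (M : ℝ) {p : Chart} (hp : 0 < ‖p.2‖) (X Y : Chart) :
    ernMetric M p partialV (christoffel (ernMetric M) p X Y) =
      1 / 2 * (fderiv ℝ (ernMetric M) p X partialV Y +
        fderiv ℝ (ernMetric M) p Y partialV X) := by
  rw [ernMetric_comm, christoffel, (isInvertible_ernMetric M hp).self_apply_inverse,
    fderiv_ernMetric_comm M hp X, fderiv_ernMetric_comm M hp Y]
  simp [christoffelFirst, fderiv_ernMetric_partialV M hp]

/-- Killing's equation for `∂_v`. -/
theorem ernMetric_covDeriv_partialV (M : ℝ) {p : Chart} (hp : 0 < ‖p.2‖) (X : Chart) :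
    ernMetric M p (covDeriv (ernMetric M) (fun _ => partialV) p X) X = 0 := by
  rw [covDeriv, christoffel, map_add, (isInvertible_ernMetric M hp).self_apply_inverse]
  simp [christoffelFirst, fderiv_ernMetric_partialV M hp,
    fderiv_ernMetric_comm M hp X X partialV]

/-! ### The static time function -/

/-- An antiderivative of `1 / f`, the Regge-Wheeler radial coordinate inside the horizon. -/
def tortoise (M r : ℝ) : ℝ := r + 2 * M * Real.log (M - r) + M ^ 2 / (M - r)

theorem hasDerivAt_tortoise {M r : ℝ} (hr : 0 < r) (hM : r < M) :
    HasDerivAt (tortoise M) (lapse M r)⁻¹ r := by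
  have h0 : M - r ≠ 0 := (sub_pos.2 hM).ne'
  have h1 : HasDerivAt (fun s => M - s) (-1) r := by
    simpa using (hasDerivAt_id r).const_sub M
  have h2 := ((hasDerivAt_id r).add ((h1.log h0).const_mul (2 * M))).add
    ((hasDerivAt_const r (M ^ 2)).div h1 h0)
  refine h2.congr_deriv ?_
  have h3 : r - M ≠ 0 := (sub_neg.2 hM).ne
  have h4 : 1 - M / r = (r - M) / r := by field_simp
  rw [lapse_eq hr.ne', h4]
  field_simp
  ring

theorem contDiffAt_tortoise {M r : ℝ} (hM : r < M) : ContDiffAt ℝ ∞ (tortoise M) r := by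
  have h0 : M - r ≠ 0 := (sub_pos.2 hM).ne'
  unfold tortoise
  fun_prop (disch := exact h0)

/-- The static time function of the black hole region. -/
def staticTime (M : ℝ) (p : Chart) : ℝ := p.1 - tortoise M ‖p.2‖

theorem contDiffAt_tortoise_norm {M : ℝ} {x : EuclideanSpace ℝ (Fin 3)} (hx : 0 < ‖x‖)
    (hM : ‖x‖ < M) : ContDiffAt ℝ ∞ (fun y : EuclideanSpace ℝ (Fin 3) => tortoise M ‖y‖) x :=
  (contDiffAt_tortoise hM).comp x (contDiffAt_norm ℝ (norm_pos_iff.1 hx))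

theorem contDiffAt_staticTime {M : ℝ} {p : Chart} (hp : p ∈ blackHole M) :
    ContDiffAt ℝ ∞ (staticTime M) p :=
  contDiffAt_fst.sub ((contDiffAt_tortoise_norm hp.1 hp.2).comp p contDiffAt_snd)

/-- The differential of the static time is the covector of `-∂_v / f`. -/
theorem hasFDerivAt_staticTime {M : ℝ} {p : Chart} (hp : p ∈ blackHole M) :
    HasFDerivAt (staticTime M) (-(lapse M ‖p.2‖)⁻¹ • ernMetric M p partialV) p := by
  have hx : p.2 ≠ 0 := norm_pos_iff.1 hp.1
  have h1 : HasFDerivAt (fun q : Chart => ‖q.2‖) (dr p) p := by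
    have h2 : HasFDerivAt (fun x : EuclideanSpace ℝ (Fin 3) => ‖x‖)
        (‖p.2‖⁻¹ • innerSL ℝ p.2) p.2 := by
      have h3 := (hasStrictFDerivAt_norm_sq p.2).hasFDerivAt.sqrt (by simpa using hx)
      simp only [norm_nonneg, Real.sqrt_sq] at h3
      refine h3.congr_fderiv ?_
      ext X
      simp
      field_simp
    exact h2.comp p hasFDerivAt_snd
  have h2 := hasFDerivAt_fst.sub
    ((hasDerivAt_tortoise hp.1 hp.2).comp_hasFDerivAt p h1)
  refine h2.congr_fderiv (ContinuousLinearMap.ext fun X => ?_)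
  have hf := (lapse_pos hp.1 hp.2).ne'
  simp only [sub_apply, smul_apply, smul_eq_mul, ContinuousLinearMap.coe_fst',
    ernMetric_partialV]
  field_simp
  ring

/-! ### Second derivative test, traces and parametrizations -/

/-- A negative second derivative would make `x` a local maximum too, so `f` would be locally
constant with second derivative zero. -/
theorem _root_.IsLocalMin.deriv_deriv_nonneg {f : ℝ → ℝ} {x : ℝ} (h : IsLocalMin f x)
    (hc : ContinuousAt f x) : 0 ≤ deriv (deriv f) x := by
  by_contra! hneg
  have hmax := isLocalMax_of_deriv_deriv_neg hneg h.deriv_eq_zero hc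
  have hconst : f =ᶠ[𝓝 x] fun _ => f x := by
    filter_upwards [h, hmax] with y h1 h2 using le_antisymm h2 h1
  have h2 := hconst.deriv.deriv_eq
  simp at h2
  exact hneg.ne h2

open scoped MatrixOrder in
-- Factoring `h = Bᵀ B` turns the trace into a sum of values of the quadratic form `A` at the rows
-- of `B`.
theorem _root_.Matrix.PosSemidef.sum_mul_nonpos {k : ℕ} {h : Matrix (Fin k) (Fin k) ℝ}
    (hh : h.PosSemidef) {A : Fin k → Fin k → ℝ}
    (hA : ∀ w : Fin k → ℝ, ∑ α, ∑ β, w α * w β * A α β ≤ 0) :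
    ∑ α, ∑ β, h α β * A α β ≤ 0 := by
  obtain ⟨B, rfl⟩ := CStarAlgebra.nonneg_iff_eq_star_mul_self.1 hh.nonneg
  have h1 : ∑ α, ∑ β, (star B * B) α β * A α β = ∑ γ, ∑ α, ∑ β, B γ α * B γ β * A α β := by
    simp only [Matrix.mul_apply, Matrix.star_apply, star_trivial, Finset.sum_mul]
    rw [Finset.sum_comm (f := fun γ α => ∑ β, B γ α * B γ β * A α β)]
    exact Finset.sum_congr rfl fun α _ => Finset.sum_comm
  rw [h1]
  exact Finset.sum_nonpos fun γ _ => hA (B γ)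

section Param

variable {E : Type*} [NormedAddCommGroup E] [NormedSpace ℝ E] {k : ℕ} {S : Set E}
  {φ : EuclideanSpace ℝ (Fin k) → E} {O : Set (EuclideanSpace ℝ (Fin k))}

theorem IsLocalParam.contDiffAt (h : IsLocalParam S φ O) {u : EuclideanSpace ℝ (Fin k)}
    (hu : u ∈ O) : ContDiffAt ℝ ∞ φ u :=
  h.smooth.contDiffAt (h.isOpen.mem_nhds hu)

theorem IsLocalParam.mem (h : IsLocalParam S φ O) {u : EuclideanSpace ℝ (Fin k)}
    (hu : u ∈ O) : φ u ∈ S := by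
  obtain ⟨V, -, hV⟩ := h.image
  exact (hV.subset (Set.mem_image_of_mem φ hu)).1

theorem IsLocalParam.eventually_mem_line (h : IsLocalParam S φ O) {u : EuclideanSpace ℝ (Fin k)}
    (hu : u ∈ O) (w : EuclideanSpace ℝ (Fin k)) : ∀ᶠ t in 𝓝 (0 : ℝ), u + t • w ∈ O := by
  have h1 : ContinuousAt (fun t : ℝ => u + t • w) 0 := by fun_prop
  exact h1.eventually_mem (h.isOpen.mem_nhds (by simpa using hu))

theorem hasDerivAt_line {F : Type*} [NormedAddCommGroup F] [NormedSpace ℝ F] (u w : F) (t : ℝ) :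
    HasDerivAt (fun t : ℝ => u + t • w) w t := by
  simpa using ((hasDerivAt_id t).smul_const w).const_add u

theorem IsLocalParam.hasDerivAt_comp_line (h : IsLocalParam S φ O)
    {u w : EuclideanSpace ℝ (Fin k)} {t : ℝ} (hu : u + t • w ∈ O) :
    HasDerivAt (fun t : ℝ => φ (u + t • w)) (fderiv ℝ φ (u + t • w) w) t :=
  ((h.contDiffAt hu).differentiableAt (by simp)).hasFDerivAt.comp_hasDerivAt t
    (hasDerivAt_line u w t)

theorem IsLocalParam.fderiv_mem_tangentVectors (h : IsLocalParam S φ O)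
    {u : EuclideanSpace ℝ (Fin k)} (hu : u ∈ O) (w : EuclideanSpace ℝ (Fin k)) :
    fderiv ℝ φ u w ∈ tangentVectors S (φ u) := by
  refine ⟨fun t => φ (u + t • w), ?_, by simp, ?_, ?_⟩
  · refine ContDiffAt.comp (0 : ℝ) ?_ (by fun_prop)
    simpa using h.contDiffAt hu
  · filter_upwards [h.eventually_mem_line hu w] with t ht using h.mem ht
  · simpa using (h.hasDerivAt_comp_line (t := 0) (w := w) (by simpa using hu)).deriv

theorem toLp_eq_sum_single (w : Fin k → ℝ) :
    WithLp.toLp 2 w = ∑ α, w α • EuclideanSpace.single α (1 : ℝ) := by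
  ext i
  simp [Finset.sum_apply, Pi.single_apply]

theorem sum_coordField (u : EuclideanSpace ℝ (Fin k)) (w : Fin k → ℝ) :
    ∑ α, w α • coordField φ α u = fderiv ℝ φ u (WithLp.toLp 2 w) := by
  simp [toLp_eq_sum_single, coordField]

theorem IsLocalParam.posSemidef_gram {g : E → E →L[ℝ] E →L[ℝ] ℝ} (hg : ∀ p X Y, g p X Y = g p Y X)
    (h : IsLocalParam S φ O) (hS : IsSpacelike g S) {u : EuclideanSpace ℝ (Fin k)} (hu : u ∈ O) :
    (gram g (φ u) fun γ => coordField φ γ u).PosSemidef := by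
  rw [Matrix.posSemidef_iff_dotProduct_mulVec]
  refine ⟨Matrix.IsHermitian.ext fun α β => by simp [gram, hg _ (coordField φ β u)], fun w => ?_⟩
  have h1 : star w ⬝ᵥ ((gram g (φ u) fun γ => coordField φ γ u).mulVec w) =
      g (φ u) (∑ α, w α • coordField φ α u) (∑ α, w α • coordField φ α u) := by
    simp only [dotProduct, Matrix.mulVec, gram, Matrix.of_apply, star_trivial, map_sum, map_smul,
      sum_apply, smul_apply, smul_eq_mul, Finset.mul_sum]
    rw [Finset.sum_comm]
    exact Finset.sum_congr rfl fun α _ => Finset.sum_congr rfl fun β _ => by ring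
  rw [h1, sum_coordField]
  rcases eq_or_ne (fderiv ℝ φ u (WithLp.toLp 2 w)) 0 with h0 | h0
  · simp [h0]
  · exact (hS _ (h.mem hu) _ (h.fderiv_mem_tangentVectors hu _) h0).le

theorem IsLocalParam.fderiv_coordField (h : IsLocalParam S φ O) {u : EuclideanSpace ℝ (Fin k)}
    (hu : u ∈ O) (α β : Fin k) :
    fderiv ℝ (coordField φ β) u (EuclideanSpace.single α 1) =
      fderiv ℝ (fderiv ℝ φ) u (EuclideanSpace.single α 1) (EuclideanSpace.single β 1) := by
  have h1 : DifferentiableAt ℝ (fderiv ℝ φ) u :=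
    ((h.contDiffAt hu).fderiv_right (m := 1) (by norm_cast)).differentiableAt (by simp)
  have h2 := (h1.hasFDerivAt.clm_apply (hasFDerivAt_const (EuclideanSpace.single β (1 : ℝ)) u))
  rw [show coordField φ β = fun y => fderiv ℝ φ y (EuclideanSpace.single β 1) from rfl, h2.fderiv]
  simp

end Param

/-! ### The minimum of the static time on a trapped submanifold -/

section MinTime

variable {M : ℝ} {k : ℕ} {S : Set Chart}
  {φ : EuclideanSpace ℝ (Fin k) → Chart} {O : Set (EuclideanSpace ℝ (Fin k))}
  {u : EuclideanSpace ℝ (Fin k)}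

theorem deriv_staticTime_comp_line (hS : S ⊆ blackHole M) (h : IsLocalParam S φ O)
    {w : EuclideanSpace ℝ (Fin k)} {t : ℝ} (hu : u + t • w ∈ O) :
    deriv (fun t : ℝ => staticTime M (φ (u + t • w))) t =
      -(lapse M ‖(φ (u + t • w)).2‖)⁻¹ *
        ernMetric M (φ (u + t • w)) partialV (fderiv ℝ φ (u + t • w) w) := by
  simpa using! ((hasFDerivAt_staticTime (hS (h.mem hu))).comp_hasDerivAt t (h.hasDerivAt_comp_line hu)).deriv

theorem isLocalMin_staticTime_comp_line (h : IsLocalParam S φ O) (hu : u ∈ O)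
    (hmin : IsMinOn (staticTime M) S (φ u)) (w : EuclideanSpace ℝ (Fin k)) :
    IsLocalMin (fun t : ℝ => staticTime M (φ (u + t • w))) 0 := by
  filter_upwards [h.eventually_mem_line hu w] with t ht
  simpa using hmin (h.mem ht)

theorem ernMetric_partialV_fderiv_eq_zero (hS : S ⊆ blackHole M) (h : IsLocalParam S φ O)
    (hu : u ∈ O) (hmin : IsMinOn (staticTime M) S (φ u)) (w : EuclideanSpace ℝ (Fin k)) :
    ernMetric M (φ u) partialV (fderiv ℝ φ u w) = 0 := by
  have h1 := (isLocalMin_staticTime_comp_line h hu hmin w).deriv_eq_zero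
  rw [deriv_staticTime_comp_line hS h (by simpa using hu)] at h1
  have h2 := lapse_pos (hS (h.mem hu)).1 (hS (h.mem hu)).2
  simpa [h2.ne'] using h1

/-- The second order condition at a point where the static time is minimal on `S`. -/
theorem second_order_staticTime (hS : S ⊆ blackHole M) (h : IsLocalParam S φ O)
    (hu : u ∈ O) (hmin : IsMinOn (staticTime M) S (φ u)) (w : EuclideanSpace ℝ (Fin k)) :
    fderiv ℝ (ernMetric M) (φ u) (fderiv ℝ φ u w) partialV (fderiv ℝ φ u w) +
      ernMetric M (φ u) partialV (fderiv ℝ (fderiv ℝ φ) u w w) ≤ 0 := by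
  have hp := hS (h.mem hu)
  have hf := lapse_pos hp.1 hp.2
  have hu0 : u + (0 : ℝ) • w ∈ O := by simpa using hu
  have hc : HasDerivAt (fun t : ℝ => φ (u + t • w)) (fderiv ℝ φ u w) 0 := by
    simpa using h.hasDerivAt_comp_line hu0
  have hg := (differentiableAt_ernMetric M hp.1).hasFDerivAt.comp_hasDerivAt_of_eq (0 : ℝ) hc
    (by simp)
  have h1 : DifferentiableAt ℝ (fderiv ℝ φ) u :=
    ((h.contDiffAt hu).fderiv_right (m := 1) (by norm_cast)).differentiableAt (by simp)
  have h2 := (h1.hasFDerivAt.comp_hasDerivAt_of_eq (0 : ℝ) (hasDerivAt_line u w 0)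
    (by simp)).clm_apply (hasDerivAt_const (0 : ℝ) w)
  have hP := (hg.clm_apply (hasDerivAt_const (0 : ℝ) partialV)).clm_apply h2
  -- The value of this derivative is irrelevant: in the product rule it multiplies `g(∂_v, dφ(w))`,
  -- which is zero at the minimum.
  have hl : DifferentiableAt ℝ (fun t : ℝ => -(lapse M ‖(φ (u + t • w)).2‖)⁻¹) 0 := by
    have h3 : (φ u).2 ≠ 0 := norm_pos_iff.1 hp.1
    have h4 : DifferentiableAt ℝ (fun t : ℝ => ‖(φ (u + t • w)).2‖) 0 :=
      (differentiableAt_snd.comp (0 : ℝ) hc.differentiableAt).norm ℝ (by simpa using h3)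
    have h5 : DifferentiableAt ℝ (fun t : ℝ => lapse M ‖(φ (u + t • w)).2‖) 0 := by
      unfold lapse
      fun_prop (disch := simp [h3])
    exact (h5.inv (by simpa using hf.ne')).neg
  have hd := hl.hasDerivAt.mul hP
  have heq : deriv (fun t : ℝ => staticTime M (φ (u + t • w))) =ᶠ[𝓝 0]
      fun t => -(lapse M ‖(φ (u + t • w)).2‖)⁻¹ *
        ernMetric M (φ (u + t • w)) partialV (fderiv ℝ φ (u + t • w) w) := by
    filter_upwards [h.eventually_mem_line hu w] with t ht
    exact deriv_staticTime_comp_line hS h ht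
  have hcont : ContinuousAt (fun t : ℝ => staticTime M (φ (u + t • w))) 0 :=
    ContinuousAt.comp_of_eq (contDiffAt_staticTime hp).continuousAt hc.continuousAt (by simp)
  have hnonneg := (isLocalMin_staticTime_comp_line h hu hmin w).deriv_deriv_nonneg hcont
  rw [heq.deriv_eq] at hnonneg
  have hnonneg' := hnonneg.trans_eq hd.deriv
  simp [ernMetric_partialV_fderiv_eq_zero hS h hu hmin w] at hnonneg'
  exact nonpos_of_mul_nonpos_right hnonneg' (inv_pos.2 hf)

/-- The sum is the expression of `second_order_staticTime` expanded in coordinates: the symmetric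
weights `w α * w β` merge the two halves of the Christoffel term. -/
theorem sum_covDerivCoord_nonpos (hS : S ⊆ blackHole M) (h : IsLocalParam S φ O)
    (hu : u ∈ O) (hmin : IsMinOn (staticTime M) S (φ u)) (w : Fin k → ℝ) :
    ∑ α, ∑ β, w α * w β * ernMetric M (φ u) partialV (covDerivCoord (ernMetric M) φ α β u)
      ≤ 0 := by
  have hp := hS (h.mem hu)
  refine le_of_eq_of_le ?_ (second_order_staticTime hS h hu hmin (WithLp.toLp 2 w))
  have hswap : ∑ α, ∑ β, w α * w β * fderiv ℝ (ernMetric M) (φ u) (coordField φ β u) partialV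
        (coordField φ α u) =
      ∑ α, ∑ β, w α * w β * fderiv ℝ (ernMetric M) (φ u) (coordField φ α u) partialV
        (coordField φ β u) := by
    rw [Finset.sum_comm]
    exact Finset.sum_congr rfl fun α _ => Finset.sum_congr rfl fun β _ => by ring
  have hfirst : fderiv ℝ (ernMetric M) (φ u) (∑ α, w α • coordField φ α u) partialV
        (∑ α, w α • coordField φ α u) =
      ∑ α, ∑ β, w α * w β * fderiv ℝ (ernMetric M) (φ u) (coordField φ α u) partialV
        (coordField φ β u) := by
    rw [← hswap]
    simp only [map_sum, map_smul, sum_apply, smul_apply, smul_eq_mul, Finset.mul_sum, mul_assoc]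
  have hsecond : ernMetric M (φ u) partialV (fderiv ℝ (fderiv ℝ φ) u
        (∑ α, w α • EuclideanSpace.single α (1 : ℝ))
        (∑ α, w α • EuclideanSpace.single α (1 : ℝ))) =
      ∑ α, ∑ β, w α * w β * ernMetric M (φ u) partialV (fderiv ℝ (fderiv ℝ φ) u
        (EuclideanSpace.single α 1) (EuclideanSpace.single β 1)) := by
    simp only [map_sum, map_smul, sum_apply, smul_apply, smul_eq_mul, Finset.mul_sum, mul_assoc]
    rw [Finset.sum_comm]
    exact Finset.sum_congr rfl fun α _ => Finset.sum_congr rfl fun β _ => by ring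
  rw [← sum_coordField, toLp_eq_sum_single, hfirst, hsecond]
  simp only [covDerivCoord, map_add, h.fderiv_coordField hu,
    ernMetric_partialV_christoffel M hp.1, mul_add, Finset.sum_add_distrib,
    mul_left_comm _ (1 / 2 : ℝ), ← Finset.mul_sum, hswap]
  ring

/-- At a point where the static time is minimal on `S`, the mean curvature vector `H` satisfies
`g(∂_v, H) ≥ 0`, so it is not future timelike. -/
theorem not_isClosedTrapped (k : ℕ) (hS : S ⊆ blackHole M) :
    ¬ IsClosedTrapped (ernMetric M) ernFuture k S := by
  intro h
  have hcont : ContinuousOn (staticTime M) S := fun p hp =>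
    (contDiffAt_staticTime (hS hp)).continuousAt.continuousWithinAt
  obtain ⟨p, hpS, hmin⟩ := h.isCompact.exists_isMinOn h.nonempty hcont
  obtain ⟨φ, O, hφ, u, hu, rfl, hH⟩ := h.isTrapped p hpS
  have hneg := ernMetric_partialV_neg_of_isFutureTimelike (hS hpS) hH
  have hcoord : ∀ β, ernMetric M (φ u) partialV (coordField φ β u) = 0 := fun β =>
    ernMetric_partialV_fderiv_eq_zero hS hφ hu hmin _
  have hsum := (hφ.posSemidef_gram (ernMetric_comm M) h.isSpacelike hu).inv.sum_mul_nonpos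
    (sum_covDerivCoord_nonpos hS hφ hu hmin)
  -- The tangential corrections in `normalPart` are orthogonal to `∂_v` by `hcoord`.
  simp [meanCurvature, normalPart, hcoord] at hneg
  linarith

end MinTime

/-! ### The static foliation and its convexity -/

/-- The hypersurface of constant static time `c` in the black hole region. -/
def staticLeaf (M c : ℝ) : Set Chart := {p | p ∈ blackHole M ∧ staticTime M p = c}

/-- The punctured ball `0 < ‖x‖ < M` over which the static leaves are graphs. -/
def puncturedBall (M : ℝ) : Set (EuclideanSpace ℝ (Fin 3)) := {x | 0 < ‖x‖ ∧ ‖x‖ < M}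

theorem isOpen_puncturedBall (M : ℝ) : IsOpen (puncturedBall M) :=
  (isOpen_lt continuous_const continuous_norm).inter (isOpen_lt continuous_norm continuous_const)

theorem isConnected_puncturedBall {M : ℝ} (hM : 0 < M) : IsConnected (puncturedBall M) := by
  have hrank : 1 < Module.rank ℝ (EuclideanSpace ℝ (Fin 3)) := by
    rw [← Module.finrank_eq_rank, finrank_euclideanSpace_fin]
    norm_num
  have h1 : IsConnected (Set.Ioo 0 M ×ˢ Metric.sphere (0 : EuclideanSpace ℝ (Fin 3)) 1) :=
    (isConnected_Ioo hM).prod (isConnected_sphere hrank 0 zero_le_one)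
  -- Polar coordinates reduce connectedness to that of an interval and of the sphere.
  have h2 : puncturedBall M = (fun q : ℝ × EuclideanSpace ℝ (Fin 3) => q.1 • q.2) ''
      (Set.Ioo 0 M ×ˢ Metric.sphere (0 : EuclideanSpace ℝ (Fin 3)) 1) := by
    ext x
    constructor
    · rintro ⟨h0, h1⟩
      refine ⟨(‖x‖, ‖x‖⁻¹ • x), ⟨⟨h0, h1⟩, ?_⟩, ?_⟩
      · simp [norm_smul, h0.ne']
      · simp [smul_smul, h0.ne']
    · rintro ⟨⟨s, y⟩, ⟨⟨h0, h1⟩, hy⟩, rfl⟩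
      have hy' : ‖y‖ = 1 := by simpa using hy
      have hnorm : ‖s • y‖ = s := by rw [norm_smul, hy', mul_one, Real.norm_of_nonneg h0.le]
      exact ⟨hnorm.symm ▸ h0, hnorm.symm ▸ h1⟩
  rw [h2]
  exact h1.image _ (by fun_prop)

/-- The graph parametrization of the leaf of static time `c`. -/
def leafParam (M c : ℝ) (x : EuclideanSpace ℝ (Fin 3)) : Chart := (tortoise M ‖x‖ + c, x)

theorem contDiffAt_leafParam {M c : ℝ} {x : EuclideanSpace ℝ (Fin 3)} (hx : x ∈ puncturedBall M) :
    ContDiffAt ℝ ∞ (leafParam M c) x :=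
  ((contDiffAt_tortoise_norm hx.1 hx.2).add contDiffAt_const).prodMk contDiffAt_id

theorem leafParam_image (M c : ℝ) : leafParam M c '' puncturedBall M = staticLeaf M c := by
  ext ⟨v, x⟩
  constructor
  · rintro ⟨y, hy, h⟩
    obtain ⟨rfl, rfl⟩ := Prod.mk.inj h
    exact ⟨hy, by simp [staticTime]⟩
  · rintro ⟨hx, h⟩
    refine ⟨x, hx, Prod.ext ?_ rfl⟩
    simp only [staticTime] at h
    simp only [leafParam]
    linarith

/-- The projection to `x` is a smooth left inverse, which gives both the immersion and the embedding
property. -/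
theorem isLocalParam_leafParam (M c : ℝ) :
    IsLocalParam (staticLeaf M c) (leafParam M c) (puncturedBall M) where
  isOpen := isOpen_puncturedBall M
  smooth := fun _ hx => (contDiffAt_leafParam hx).contDiffWithinAt
  immersion := fun x hx => by
    have h1 := ((contDiffAt_leafParam (c := c) hx).differentiableAt (by simp)).hasFDerivAt.snd
    have h2 := h1.unique (hasFDerivAt_id x)
    intro X Y hXY
    have h3 := congrArg Prod.snd hXY
    have h4 := fun Z => DFunLike.congr_fun h2 Z
    simp only [ContinuousLinearMap.comp_apply, ContinuousLinearMap.coe_snd'] at h4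
    simpa [h4] using h3
  isEmbedding := by
    have h1 : Continuous ((puncturedBall M).domRestrict (leafParam M c)) :=
      continuousOn_iff_continuous_domRestrict.1 fun _ hx =>
        (contDiffAt_leafParam hx).continuousAt.continuousWithinAt
    exact Topology.IsEmbedding.of_comp h1 continuous_snd Topology.IsEmbedding.subtypeVal
  image := ⟨Set.univ, isOpen_univ, by rw [leafParam_image, Set.inter_univ]⟩

theorem isSubmanifold_staticLeaf (M c : ℝ) : IsSubmanifold 3 (staticLeaf M c) := fun p hp =>
  ⟨leafParam M c, puncturedBall M, isLocalParam_leafParam M c, by rwa [leafParam_image]⟩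

theorem isConnected_staticLeaf {M : ℝ} (hM : 0 < M) (c : ℝ) : IsConnected (staticLeaf M c) := by
  rw [← leafParam_image]
  exact (isConnected_puncturedBall hM).image _ fun _ hx =>
    (contDiffAt_leafParam hx).continuousAt.continuousWithinAt

theorem contDiffAt_leafParam_uncurry {M : ℝ} {q : EuclideanSpace ℝ (Fin 3) × ℝ}
    (hq : q.1 ∈ puncturedBall M) :
    ContDiffAt ℝ ∞ (fun q : EuclideanSpace ℝ (Fin 3) × ℝ => leafParam M q.2 q.1) q :=
  (((contDiffAt_tortoise_norm hq.1 hq.2).comp q contDiffAt_fst).add contDiffAt_snd).prodMk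
    contDiffAt_fst

/-- The flat chart `(v, x) ↦ (x, t)` of the foliation by level sets of the static time `t`. -/
def staticChart {M : ℝ} (U : Set (EuclideanSpace ℝ (Fin 3))) (I : Set ℝ) (hU : IsOpen U)
    (hI : IsOpen I) (hUM : U ⊆ puncturedBall M) :
    OpenPartialHomeomorph Chart (EuclideanSpace ℝ (Fin 3) × ℝ) where
  toFun p := (p.2, staticTime M p)
  invFun q := leafParam M q.2 q.1
  source := {p | p.2 ∈ U ∧ staticTime M p ∈ I}
  target := U ×ˢ I
  map_source' := fun p hp => hp
  map_target' := fun q hq => by simpa [leafParam, staticTime] using hq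
  left_inv' := fun p _ => by simp [leafParam, staticTime]
  right_inv' := fun q _ => by simp [leafParam, staticTime]
  open_source := by
    have h1 : ContinuousOn (staticTime M) (Prod.snd ⁻¹' U) := fun p hp =>
      (contDiffAt_staticTime (hUM hp)).continuousAt.continuousWithinAt
    exact h1.isOpen_inter_preimage (hU.preimage continuous_snd) hI
  open_target := hU.prod hI
  continuousOn_toFun := continuous_snd.continuousOn.prodMk fun p hp =>
    (contDiffAt_staticTime (hUM hp.1)).continuousAt.continuousWithinAt
  continuousOn_invFun := fun _ hq =>
    (contDiffAt_leafParam_uncurry (hUM hq.1)).continuousAt.continuousWithinAt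

theorem isHypersurfaceFoliation_staticLeaf {M : ℝ} (hM : 0 < M) :
    IsHypersurfaceFoliation 3 (blackHole M) (Set.range (staticLeaf M)) where
  isSubmanifold := by
    rintro _ ⟨c, rfl⟩
    exact isSubmanifold_staticLeaf M c
  isConnected := by
    rintro _ ⟨c, rfl⟩
    exact isConnected_staticLeaf hM c
  disjoint := by
    rintro _ ⟨c, rfl⟩ _ ⟨d, rfl⟩ hne
    refine Set.disjoint_left.2 fun p hc hd => hne ?_
    rw [← hc.2, ← hd.2]
  cover := by
    ext p
    simp [staticLeaf]
  flatChart := fun p hp => by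
    obtain ⟨ρ, hρ, hball⟩ := Metric.isOpen_iff.1 (isOpen_puncturedBall M) p.2 hp
    let Ψ := staticChart (Metric.ball p.2 ρ) (Set.Ioo (staticTime M p - 1) (staticTime M p + 1))
      Metric.isOpen_ball isOpen_Ioo hball
    refine ⟨Ψ, ⟨Metric.mem_ball_self hρ, by simp, by simp⟩, fun q hq => hball hq.1,
      fun q hq => ?_, fun q hq => ?_, ⟨p.2, ρ, _, _, rfl⟩, ?_⟩
    · exact (contDiffAt_snd.prodMk (contDiffAt_staticTime (hball hq.1))).contDiffWithinAt
    · exact (contDiffAt_leafParam_uncurry (hball hq.1)).contDiffWithinAt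
    · rintro _ ⟨c, rfl⟩
      -- The last chart coordinate is `t` itself, so a leaf meets the chart in at most one slice.
      refine ⟨{c}, Set.countable_singleton c, ?_⟩
      ext q
      constructor
      · rintro ⟨h1, h2⟩
        exact ⟨h2, h1.2⟩
      · rintro ⟨h1, h2⟩
        exact ⟨⟨hball h1.1, h2⟩, h1⟩

theorem ernMetric_partialV_of_mem_tangentVectors {M c : ℝ} {p w : Chart}
    (hp : p ∈ staticLeaf M c) (hw : w ∈ tangentVectors (staticLeaf M c) p) :
    ernMetric M p partialV w = 0 := by
  obtain ⟨γ, hγ, rfl, hmem, rfl⟩ := hw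
  have h1 := (hasFDerivAt_staticTime hp.1).comp_hasDerivAt (0 : ℝ)
    (hγ.differentiableAt (by simp)).hasDerivAt
  have h2 : staticTime M ∘ γ =ᶠ[𝓝 0] fun _ => c := by
    filter_upwards [hmem] with t ht using ht.2
  have h3 := h1.unique ((hasDerivAt_const (0 : ℝ) c).congr_of_eventuallyEq h2)
  have hf := lapse_pos hp.1.1 hp.1.2
  simpa [hf.ne'] using h3

/-- Orthogonality means `dr = f dv` on `w`, so `g(w, w)` is `f dv(w)²` plus the nonnegative angular
part. -/
theorem ernMetric_pos_of_orthogonal {M : ℝ} {p w : Chart} (hp : p ∈ blackHole M)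
    (hw : ernMetric M p partialV w = 0) (hw0 : w ≠ 0) : 0 < ernMetric M p w w := by
  have hf := lapse_pos hp.1 hp.2
  have hdr : dr p w = lapse M ‖p.2‖ * w.1 := by
    rw [ernMetric_partialV] at hw
    linarith
  have hsq := dr_sq_le p w
  have hval : ernMetric M p w w =
      lapse M ‖p.2‖ * w.1 ^ 2 + (inner ℝ w.2 w.2 - dr p w ^ 2) := by
    rw [ernMetric_apply, hdr]
    ring
  rw [hval]
  rcases eq_or_ne w.1 0 with h | h
  · have h2 : w.2 ≠ 0 := fun h2 => hw0 (Prod.ext h h2)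
    have h3 := real_inner_self_pos.2 h2
    simpa [hdr, h] using h3
  · have := mul_pos hf (sq_pos_of_ne_zero h)
    linarith

theorem isSpacelike_staticLeaf (M c : ℝ) : IsSpacelike (ernMetric M) (staticLeaf M c) :=
  fun _ hp _ hw hw0 =>
    ernMetric_pos_of_orthogonal hp.1 (ernMetric_partialV_of_mem_tangentVectors hp hw) hw0

theorem isFutureConvex_staticLeaf (M c : ℝ) :
    IsFutureConvex (ernMetric M) ernFuture 1 (staticLeaf M c) := by
  refine ⟨fun _ => partialV, Set.univ, isOpen_univ, Set.subset_univ _, contDiffOn_const,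
    fun p hp => ⟨(isFutureTimelike_partialV hp.1).2,
      fun w hw => ernMetric_partialV_of_mem_tangentVectors hp hw, fun e _ _ => ?_⟩⟩
  -- For `k = 1` the trace is a single term, a multiple of `g(∇_e ∂_v, e) = 0`.
  simp [ernMetric_covDeriv_partialV M hp.1.1]

end Trapped

end

theorem mainTheorem9 (M : ℝ) (hM : 0 < M) :
    (∀ p ∈ blackHole M, IsFutureTimelike (ernMetric M) ernFuture p partialV) ∧
    (∃ 𝓛 : Set (Set Chart), IsHypersurfaceFoliation 3 (blackHole M) 𝓛 ∧
      ∀ L ∈ 𝓛, IsSpacelike (ernMetric M) L ∧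
        (∀ p ∈ L, ∀ w ∈ tangentVectors L p, ernMetric M p partialV w = 0) ∧
        IsFutureConvex (ernMetric M) ernFuture 1 L) ∧
    (¬ ∃ S : Set Chart, S ⊆ blackHole M ∧
      IsClosedTrappedSurface (ernMetric M) ernFuture S) ∧
    (¬ ∃ S : Set Chart, S ⊆ blackHole M ∧
      IsTrappedLoop (ernMetric M) ernFuture S) := by
  refine ⟨fun p hp => isFutureTimelike_partialV hp,
    ⟨Set.range (staticLeaf M), isHypersurfaceFoliation_staticLeaf hM, ?_⟩,
    fun ⟨S, hS, h⟩ => not_isClosedTrapped _ hS h, fun ⟨S, hS, h⟩ => not_isClosedTrapped _ hS h⟩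
  rintro _ ⟨c, rfl⟩
  exact ⟨isSpacelike_staticLeaf M c,
    fun p hp w hw => ernMetric_partialV_of_mem_tangentVectors hp hw, isFutureConvex_staticLeaf M c⟩
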